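/- Let $d \ge 2$ be an integer and let $t$ be a real number with $\frac1d < t < \frac1{d-1}$. A brick is a closed box $\prod_{j=1}^d [a_j, a_j + \ell_j] \subset \mathbb{R}^d$ with all $\ell_j > 0$; its side lengths are $\ell_1,\dots,\ell_d$, and it is a cube of sidelength $\ell$ if $\ell_1 = \dots = \ell_d = \ell$. Then there is an integer $N_0 \ge 1$, depending only on $d$ and $t$, such that for every integer $n_0 \ge N_0$ the series $\sum_{n=n_0}^\infty \frac{1}{n^{dt}}$ converges and the cubes of sidelength $n^{-t}$, $n \ge n_0$, perfectly pack every cube $\Omega \subset \mathbb{R}^d$ of volume $\sum_{n=n_0}^\infty \frac{1}{n^{dt}}$. That is, there are cubes $Q_n \subseteq \Omega$ ($n \ge n_0$), with $Q_n$ of sidelength $n^{-t}$, whose interiors are pairwise disjoint and for which $\Omega \setminus \bigcup_{n \ge n_0} Q_n$ has Lebesgue measure $0$. -/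

import Mathlib

/-- `B` is a closed `d`-dimensional brick with positive side lengths `s 0, …, s (d - 1)` whose facets
are parallel to the coordinate hyperplanes: the side lengths may be distributed over the coordinate
axes in any order `σ`, and the minimal corner `a` is arbitrary. -/
def IsBrickWithSides {d : ℕ} (s : Fin d → ℝ) (B : Set (Fin d → ℝ)) : Prop :=
  (∀ j, 0 < s j) ∧
    ∃ (σ : Equiv.Perm (Fin d)) (a : Fin d → ℝ), B = Set.Icc a (fun j => a j + s (σ j))

/-- A cube is a brick with equal side lengths. -/
def IsCube {d : ℕ} (B : Set (Fin d → ℝ)) : Prop :=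
  ∃ L : ℝ, IsBrickWithSides (fun _ => L) B

/-- `P` is a packing in `Ω` of the bricks with side lengths `s i`, `i : ι`. -/
structure IsPackingIn {d : ℕ} {ι : Type*} (s : ι → Fin d → ℝ) (Ω : Set (Fin d → ℝ))
    (P : ι → Set (Fin d → ℝ)) : Prop where
  isBrick : ∀ i, IsBrickWithSides (s i) (P i)
  disjoint_interior : ∀ i j, i ≠ j → Disjoint (interior (P i)) (interior (P j))
  subset : ∀ i, P i ⊆ Ω

/-- The bricks with side lengths `s i`, `i : ι`, perfectly pack `Ω`: they have a packing in `Ω` whose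
complement in `Ω` has Lebesgue measure zero. -/
def PerfectlyPack {d : ℕ} {ι : Type*} (s : ι → Fin d → ℝ) (Ω : Set (Fin d → ℝ)) : Prop :=
  ∃ P : ι → Set (Fin d → ℝ), IsPackingIn s Ω P ∧ MeasureTheory.volume (Ω \ ⋃ i, P i) = 0

/-!
The cubes are placed greedily. Suppose that the next cube to be placed is the `N`-th one and that
the part of `Ω` not yet covered is a finite union of boxes, one of which is wide: all its sides
are at least `N ^ (-t + c * ε)`, where `c = 1 - (d - 1) * t > 0` and `ε` is small. Cut from this
box a layer of cells of side `N ^ (-t)`, one cell thick, and put one of the next cubes into each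
cell. There are only `O(N ^ (1 - c))` cells, so the cubes nearly fill them.

It remains to see that there always is a wide box. The weight of a box is its surface area in
which each facet is multiplied by the `ε`-th power of the corresponding width. Filling a layer of
`k` cells raises the total weight of the uncovered boxes by `O(k * N ^ (α - 1))`, where
`α = c - (t + c) * ε`, so that this weight is `O(N ^ α)` throughout. If no box were wide, the
uncovered volume would be at most `N ^ ((-t + c * ε) * (1 - ε))` times the weight, which is
`O(N ^ (1 - d * t - c * ε ^ 2))`. But the uncovered volume is the total volume of the cubes still
to be placed, of order `N ^ (1 - d * t)`.
-/

open MeasureTheory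

theorem indicator_Ico_add {α : Type*} [LinearOrder α] {a b c : α} (hab : a ≤ b) (hbc : b ≤ c) :
    (Set.Ico a b).indicator (1 : α → ℝ) + (Set.Ico b c).indicator 1 =
      (Set.Ico a c).indicator 1 := by
  rw [← Set.Ico_union_Ico_eq_Ico hab hbc, Set.indicator_union_of_disjoint Set.Ico_disjoint_Ico_same]
  rfl

theorem sum_indicator_Ico {α : Type*} [LinearOrder α] {a : ℕ → α} (ha : Monotone a) (m : ℕ) :
    ∑ k ∈ Finset.range m, (Set.Ico (a k) (a (k + 1))).indicator (1 : α → ℝ) =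
      (Set.Ico (a 0) (a m)).indicator 1 := by
  induction m with
  | zero => rw [Finset.sum_range_zero, Set.Ico_self, Set.indicator_empty']
  | succ m ih =>
    rw [Finset.sum_range_succ, ih, indicator_Ico_add (ha m.zero_le) (ha m.le_succ)]

/-- A half-open axis-parallel box `∏ j, [lo j, lo j + side j)`, empty if one of its sides is `0`.
With half-open boxes, cutting a box into pieces is an identity between indicator functions, which
can be integrated and substituted into other such identities. -/
structure HalfOpenBox (d : ℕ) where
  lo : Fin d → ℝ
  side : Fin d → ℝ
  side_nonneg : 0 ≤ side

namespace HalfOpenBox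

variable {d : ℕ}

/-- The points of the box. -/
def toSet (B : HalfOpenBox d) : Set (Fin d → ℝ) :=
  Set.univ.pi fun j => Set.Ico (B.lo j) (B.lo j + B.side j)

/-- The volume of the box. -/
def vol (B : HalfOpenBox d) : ℝ := ∏ j, B.side j

/-- The indicator function of the box. -/
noncomputable def indicator (B : HalfOpenBox d) : (Fin d → ℝ) → ℝ := B.toSet.indicator 1

theorem indicator_apply (B : HalfOpenBox d) (x : Fin d → ℝ) :
    B.indicator x = ∏ j, (Set.Ico (B.lo j) (B.lo j + B.side j)).indicator 1 (x j) := by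
  simpa [indicator, toSet] using Set.indicator_pi_one_apply Finset.univ
    (fun j => Set.Ico (B.lo j) (B.lo j + B.side j)) x

theorem indicator_nonneg (B : HalfOpenBox d) (x : Fin d → ℝ) : 0 ≤ B.indicator x :=
  Set.indicator_nonneg (fun _ _ => zero_le_one) x

theorem indicator_of_mem {B : HalfOpenBox d} {x : Fin d → ℝ} (hx : x ∈ B.toSet) :
    B.indicator x = 1 :=
  Set.indicator_of_mem hx 1

theorem indicator_le_one (B : HalfOpenBox d) (x : Fin d → ℝ) : B.indicator x ≤ 1 :=
  Set.indicator_le_self' (fun _ _ => zero_le_one) x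

theorem toSet_subset_of_indicator_le {B C : HalfOpenBox d}
    (h : ∀ x, B.indicator x ≤ C.indicator x) : B.toSet ⊆ C.toSet := fun x hx => by
  by_contra hxC
  have := h x
  rw [indicator_of_mem hx, indicator, Set.indicator_of_notMem hxC] at this
  exact zero_lt_one.not_ge this

theorem measurableSet_toSet (B : HalfOpenBox d) : MeasurableSet B.toSet :=
  MeasurableSet.univ_pi fun _ => measurableSet_Ico

theorem volume_toSet (B : HalfOpenBox d) : volume B.toSet = ENNReal.ofReal B.vol := by
  simp [toSet, vol, volume_pi_pi, ENNReal.ofReal_prod_of_nonneg fun j _ => B.side_nonneg j]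

theorem vol_nonneg (B : HalfOpenBox d) : 0 ≤ B.vol :=
  Finset.prod_nonneg fun j _ => B.side_nonneg j

theorem integral_indicator (B : HalfOpenBox d) : ∫ x, B.indicator x = B.vol := by
  rw [indicator, integral_indicator_one B.measurableSet_toSet, measureReal_def, B.volume_toSet,
    ENNReal.toReal_ofReal B.vol_nonneg]

theorem integrable_indicator (B : HalfOpenBox d) : Integrable B.indicator :=
  (integrable_indicator_iff B.measurableSet_toSet).2
    (integrableOn_const (by rw [B.volume_toSet]; exact ENNReal.ofReal_ne_top))

theorem toSet_subset_Icc (B : HalfOpenBox d) : B.toSet ⊆ Set.Icc B.lo (B.lo + B.side) := by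
  rw [← Set.pi_univ_Icc]
  exact Set.pi_mono fun _ _ => Set.Ico_subset_Icc_self

theorem interior_Icc_subset_toSet (B : HalfOpenBox d) :
    interior (Set.Icc B.lo (B.lo + B.side)) ⊆ B.toSet := by
  rw [← Set.pi_univ_Icc, interior_pi_set Set.finite_univ]
  exact Set.pi_mono fun _ _ => interior_Icc.trans_subset Set.Ioo_subset_Ico_self

theorem closure_toSet {B : HalfOpenBox d} (hB : ∀ j, 0 < B.side j) :
    closure B.toSet = Set.Icc B.lo (B.lo + B.side) := by
  rw [toSet, closure_pi_set, ← Set.pi_univ_Icc]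
  exact Set.pi_congr rfl fun j _ => closure_Ico (lt_add_of_pos_right _ (hB j)).ne

theorem side_le_of_toSet_subset {B W : HalfOpenBox d} (hB : ∀ j, 0 < B.side j)
    (h : B.toSet ⊆ W.toSet) (j : Fin d) : B.side j ≤ W.side j := by
  rcases Set.univ_pi_subset_univ_pi_iff.1 h with h | ⟨i, hi⟩
  · have := (Set.Ico_subset_Ico_iff (lt_add_of_pos_right _ (hB j))).1 (h j)
    linarith
  · exact absurd (lt_add_of_pos_right _ (hB i)) (Set.Ico_eq_empty_iff.1 hi)

/-- The number of boxes of `Q` that contain a given point. -/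
noncomputable def coverage (Q : Multiset (HalfOpenBox d)) : (Fin d → ℝ) → ℝ :=
  (Q.map indicator).sum

@[simp] theorem coverage_singleton (B : HalfOpenBox d) : coverage {B} = B.indicator := by
  simp [coverage]

@[simp] theorem coverage_add (Q R : Multiset (HalfOpenBox d)) :
    coverage (Q + R) = coverage Q + coverage R := by
  simp [coverage]

@[simp] theorem coverage_cons (B : HalfOpenBox d) (Q : Multiset (HalfOpenBox d)) :
    coverage (B ::ₘ Q) = B.indicator + coverage Q := by
  simp [coverage]

@[simp] theorem coverage_map_val {κ : Type*} (s : Finset κ) (B : κ → HalfOpenBox d) :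
    coverage (s.val.map B) = ∑ k ∈ s, (B k).indicator := by
  rw [coverage, Multiset.map_map]
  rfl

theorem coverage_nonneg (Q : Multiset (HalfOpenBox d)) : 0 ≤ coverage Q :=
  Multiset.sum_nonneg fun f hf => by
    obtain ⟨B, -, rfl⟩ := Multiset.mem_map.1 hf
    exact B.indicator_nonneg

theorem indicator_le_coverage {Q : Multiset (HalfOpenBox d)} {B : HalfOpenBox d} (hB : B ∈ Q)
    (x : Fin d → ℝ) : B.indicator x ≤ coverage Q x := by
  obtain ⟨Q, rfl⟩ := Multiset.exists_cons_of_mem hB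
  rw [coverage_cons]
  exact le_add_of_nonneg_right (coverage_nonneg Q x)

theorem integrable_coverage (Q : Multiset (HalfOpenBox d)) : Integrable (coverage Q) := by
  induction Q using Multiset.induction with
  | empty => exact integrable_zero _ _ _
  | cons B Q ih => rw [coverage_cons]; exact B.integrable_indicator.add ih

theorem integral_coverage (Q : Multiset (HalfOpenBox d)) :
    ∫ x, coverage Q x = (Q.map vol).sum := by
  induction Q using Multiset.induction with
  | empty => simp [coverage]
  | cons B Q ih =>
    simp only [coverage_cons, Pi.add_apply, Multiset.map_cons, Multiset.sum_cons]
    rw [integral_add B.integrable_indicator (integrable_coverage Q), B.integral_indicator, ih]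

section Cutting

variable (B : HalfOpenBox d) {u : Fin d → ℝ} (hu : 0 ≤ u) (huB : u ≤ B.side)

/-- The box with the same minimal corner as `B` and with sides `u`. -/
def corner : HalfOpenBox d := ⟨B.lo, u, hu⟩

/-- The boxes which, together with `B.corner hu`, make up `B`: the `i`-th one consists of the points
of `B` for which `i` is the first coordinate that leaves the corner. -/
def collar (i : Fin d) : HalfOpenBox d where
  lo j := if j = i then B.lo j + u j else B.lo j
  side j := if j < i then u j else if j = i then B.side j - u j else B.side j
  side_nonneg j := by
    dsimp only
    split_ifs
    exacts [hu j, sub_nonneg.2 (huB j), B.side_nonneg j]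

theorem collar_side_le (i j : Fin d) : (B.collar hu huB i).side j ≤ B.side j := by
  have h₀ : 0 ≤ u j := hu j
  have h₁ := huB j
  simp only [collar]
  split_ifs <;> linarith

theorem indicator_corner_add_sum_collar :
    (B.corner hu).indicator + ∑ i, (B.collar hu huB i).indicator = B.indicator := by
  ext x
  set f : Fin d → ℝ := fun j => (Set.Ico (B.lo j) (B.lo j + B.side j)).indicator 1 (x j) with hf
  set g : Fin d → ℝ := fun j => (Set.Ico (B.lo j + u j) (B.lo j + B.side j)).indicator 1 (x j)
  have hsub (j : Fin d) :
      (Set.Ico (B.lo j) (B.lo j + u j)).indicator 1 (x j) = f j - g j := by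
    have h₀ : B.lo j ≤ B.lo j + u j := le_add_of_nonneg_right (hu j)
    have h₁ : B.lo j + u j ≤ B.lo j + B.side j := add_le_add_right (huB j) _
    exact eq_sub_of_add_eq (congrFun (indicator_Ico_add h₀ h₁) (x j))
  have hcollar (i : Fin d) : (B.collar hu huB i).indicator x =
      g i * (∏ j with j < i, (f j - g j)) * ∏ j with i < j, f j := by
    have hfactor (j : Fin d) : (Set.Ico ((B.collar hu huB i).lo j)
        ((B.collar hu huB i).lo j + (B.collar hu huB i).side j)).indicator 1 (x j) =
        (if j = i then g j else 1) * (if j < i then f j - g j else 1) *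
          if i < j then f j else 1 := by
      rcases lt_trichotomy j i with hj | rfl | hj
      · simp [collar, hj, hj.ne, hj.le.not_gt, hsub]
      · simp [collar, g, add_assoc]
      · simp [collar, hj, hj.ne', hj.le.not_gt, hf]
    simp only [indicator_apply, hfactor, Finset.prod_mul_distrib, Finset.prod_ite_eq',
      Finset.mem_univ, if_true, Finset.prod_filter]
  simp only [Pi.add_apply, Finset.sum_apply, hcollar, indicator_apply B]
  simp only [indicator_apply, corner, hsub]
  rw [Finset.prod_sub_ordered, sub_add_cancel]

end Cutting

section Grid

variable (B : HalfOpenBox d) {s : ℝ} (hs : 0 ≤ s)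

/-- The cell with index `κ` of the grid of mesh `s` based at the minimal corner of `B`. -/
def cell (κ : Fin d → ℕ) : HalfOpenBox d where
  lo j := B.lo j + κ j * s
  side _ := s
  side_nonneg _ := hs

theorem sum_indicator_cell {m : Fin d → ℕ} (hm : 0 ≤ fun j => m j * s) :
    ∑ κ ∈ Fintype.piFinset fun j => Finset.range (m j), (B.cell hs κ).indicator =
      (B.corner hm).indicator := by
  ext x
  have hmono (j : Fin d) : Monotone fun k : ℕ => B.lo j + k * s := fun k l hkl => by
    dsimp only
    gcongr
  have hline (j : Fin d) := congrFun (sum_indicator_Ico (hmono j) (m j)) (x j)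
  simp only [Finset.sum_apply, Nat.cast_add, Nat.cast_one, add_one_mul, Nat.cast_zero, zero_mul,
    add_zero, ← add_assoc] at hline
  simp only [Finset.sum_apply, indicator_apply, cell, corner, ← hline, Finset.prod_univ_sum]

end Grid

section Weight

variable {ε θ : ℝ} {B C : HalfOpenBox d}

/-- The contribution of the facets orthogonal to the `j`-th axis to `HalfOpenBox.weight`. -/
noncomputable def facetWeight (ε : ℝ) (B : HalfOpenBox d) (j : Fin d) : ℝ :=
  B.side j ^ ε * ∏ i ∈ Finset.univ.erase j, B.side i

/-- A regularized surface area of `B`: each pair of opposite facets counts with its area times the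
`ε`-th power of the distance between the two. -/
noncomputable def weight (ε : ℝ) (B : HalfOpenBox d) : ℝ := ∑ j, B.facetWeight ε j

theorem facetWeight_nonneg (ε : ℝ) (B : HalfOpenBox d) (j : Fin d) : 0 ≤ B.facetWeight ε j :=
  mul_nonneg (Real.rpow_nonneg (B.side_nonneg j) _) (Finset.prod_nonneg fun i _ => B.side_nonneg i)

theorem weight_mono (hε : 0 ≤ ε) (h : B.side ≤ C.side) : B.weight ε ≤ C.weight ε :=
  Finset.sum_le_sum fun j _ => mul_le_mul (Real.rpow_le_rpow (B.side_nonneg j) (h j) hε)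
    (Finset.prod_le_prod (fun i _ => B.side_nonneg i) fun i _ => h i)
    (Finset.prod_nonneg fun i _ => B.side_nonneg i) (Real.rpow_nonneg (C.side_nonneg j) _)

theorem facetWeight_le {r : ℝ} (hε : ε ≤ 1) (hr : 0 < r) (hB : ∀ j, r ≤ B.side j) (j : Fin d) :
    B.facetWeight ε j ≤ r ^ (ε - 1) * B.vol := by
  have hj : 0 < B.side j := hr.trans_le (hB j)
  have hprod : 0 ≤ ∏ i ∈ Finset.univ.erase j, B.side i :=
    Finset.prod_nonneg fun i _ => B.side_nonneg i
  rw [vol, facetWeight, ← Finset.mul_prod_erase _ B.side (Finset.mem_univ j), ← mul_assoc]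
  gcongr
  calc B.side j ^ ε = B.side j ^ (ε - 1) * B.side j := by
        rw [← Real.rpow_add_one hj.ne', sub_add_cancel]
    _ ≤ r ^ (ε - 1) * B.side j := mul_le_mul_of_nonneg_right
        (Real.rpow_le_rpow_of_nonpos hr (hB j) (sub_nonpos.2 hε)) hj.le

theorem weight_le_of_side_le {r : ℝ} {u : Fin d → ℝ} (hε₀ : 0 ≤ ε) (hε₁ : ε ≤ 1) (hr : 0 < r)
    (hB : B.side ≤ u) (hu : ∀ j, r ≤ u j) : B.weight ε ≤ d * (r ^ (ε - 1) * ∏ j, u j) := by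
  let C : HalfOpenBox d := ⟨B.lo, u, B.side_nonneg.trans hB⟩
  calc B.weight ε ≤ C.weight ε := weight_mono hε₀ hB
    _ ≤ ∑ _j : Fin d, r ^ (ε - 1) * C.vol :=
      Finset.sum_le_sum fun j _ => facetWeight_le hε₁ hr hu j
    _ = d * (r ^ (ε - 1) * ∏ j, u j) := by simp [C, vol]

theorem vol_le_rpow_mul_weight (hε : ε ≤ 1) {j : Fin d} (hj : B.side j ≤ θ) :
    B.vol ≤ θ ^ (1 - ε) * B.weight ε := by
  have hB : 0 ≤ B.side j := B.side_nonneg j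
  have hθ : 0 ≤ θ := hB.trans hj
  have hpow : B.side j ≤ θ ^ (1 - ε) * B.side j ^ ε := by
    rcases hB.eq_or_lt with h₀ | h₀
    · rw [← h₀]
      positivity
    · calc B.side j = B.side j ^ (1 - ε) * B.side j ^ ε := by
            rw [← Real.rpow_add h₀, sub_add_cancel, Real.rpow_one]
        _ ≤ θ ^ (1 - ε) * B.side j ^ ε := by
            gcongr
  calc B.vol = B.side j * ∏ i ∈ Finset.univ.erase j, B.side i :=
        (Finset.mul_prod_erase _ B.side (Finset.mem_univ j)).symm
    _ ≤ θ ^ (1 - ε) * B.side j ^ ε * ∏ i ∈ Finset.univ.erase j, B.side i := by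
        gcongr
        exact Finset.prod_nonneg fun i _ => B.side_nonneg i
    _ = θ ^ (1 - ε) * B.facetWeight ε j := mul_assoc _ _ _
    _ ≤ θ ^ (1 - ε) * B.weight ε := by
        gcongr
        exact Finset.single_le_sum (fun i _ => B.facetWeight_nonneg ε i) (Finset.mem_univ j)

theorem exists_forall_le_side (hε : ε ≤ 1) {Q : Multiset (HalfOpenBox d)}
    (hQ : θ ^ (1 - ε) * (Q.map (weight ε)).sum < (Q.map vol).sum) :
    ∃ B ∈ Q, ∀ j, θ ≤ B.side j := by
  contrapose! hQ
  rw [← Multiset.sum_map_mul_left]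
  refine Multiset.sum_map_le_sum_map _ _ fun B hB => ?_
  obtain ⟨j, hj⟩ := hQ B hB
  exact vol_le_rpow_mul_weight hε hj.le

end Weight

end HalfOpenBox

open HalfOpenBox

/-- The boxes of `S` are cut into the boxes `P n`, `N ≤ n < N'`, which are cubes with sides `r n`,
and the boxes of `Q`. -/
structure IsPartialPacking {d : ℕ} (r : ℕ → ℝ) (S : Multiset (HalfOpenBox d)) (N N' : ℕ)
    (P : ℕ → HalfOpenBox d) (Q : Multiset (HalfOpenBox d)) : Prop where
  le : N ≤ N'
  side_eq : ∀ n ∈ Finset.Ico N N', (P n).side = fun _ => r n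
  coverage_eq : ∑ n ∈ Finset.Ico N N', (P n).indicator + coverage Q = coverage S

namespace IsPartialPacking

variable {d : ℕ} {r : ℕ → ℝ} {S S' Q Q' : Multiset (HalfOpenBox d)} {N N' N'' : ℕ}
  {P P' : ℕ → HalfOpenBox d}

theorem refl (r : ℕ → ℝ) (S : Multiset (HalfOpenBox d)) (N : ℕ) (P : ℕ → HalfOpenBox d) :
    IsPartialPacking r S N N P S where
  le := le_rfl
  side_eq := by simp
  coverage_eq := by simp

theorem congr (h : IsPartialPacking r S N N' P Q) (hP : ∀ n ∈ Finset.Ico N N', P' n = P n) :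
    IsPartialPacking r S N N' P' Q where
  le := h.le
  side_eq n hn := by rw [hP n hn, h.side_eq n hn]
  coverage_eq := by rw [Finset.sum_congr rfl fun n hn => by rw [hP n hn], h.coverage_eq]

theorem trans (h : IsPartialPacking r S N N' P Q) (h' : IsPartialPacking r Q N' N'' P Q') :
    IsPartialPacking r S N N'' P Q' where
  le := h.le.trans h'.le
  side_eq n hn := by
    rw [Finset.mem_Ico] at hn
    rcases lt_or_ge n N' with hn' | hn'
    · exact h.side_eq n (Finset.mem_Ico.2 ⟨hn.1, hn'⟩)
    · exact h'.side_eq n (Finset.mem_Ico.2 ⟨hn', hn.2⟩)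
  coverage_eq := by
    rw [← Finset.sum_Ico_consecutive _ h.le h'.le, add_assoc, h'.coverage_eq, h.coverage_eq]

theorem add_right (h : IsPartialPacking r S N N' P Q) (T : Multiset (HalfOpenBox d)) :
    IsPartialPacking r (S + T) N N' P (Q + T) where
  le := h.le
  side_eq := h.side_eq
  coverage_eq := by rw [coverage_add, coverage_add, ← add_assoc, h.coverage_eq]

theorem exists_append (h : IsPartialPacking r S N N' P Q)
    (h' : IsPartialPacking r Q N' N'' P' Q') :
    ∃ P'', (∀ n < N', P'' n = P n) ∧ IsPartialPacking r S N N'' P'' Q' :=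
  ⟨fun n => if n < N' then P n else P' n, fun _ hn => if_pos hn,
    (h.congr fun _ hn => if_pos (Finset.mem_Ico.1 hn).2).trans
      (h'.congr fun _ hn => if_neg (Finset.mem_Ico.1 hn).1.not_gt)⟩

theorem sum_vol (h : IsPartialPacking r S N N' P Q) :
    ∑ n ∈ Finset.Ico N N', r n ^ d + (Q.map vol).sum = (S.map vol).sum := by
  have hP : ∑ n ∈ Finset.Ico N N', r n ^ d = ∑ n ∈ Finset.Ico N N', (P n).vol :=
    Finset.sum_congr rfl fun n hn => by simp [vol, h.side_eq n hn]
  rw [hP, ← integral_coverage, ← integral_coverage, ← h.coverage_eq,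
    integral_add' (integrable_finsetSum' _ fun n _ => (P n).integrable_indicator)
      (integrable_coverage Q)]
  simp only [Finset.sum_apply]
  rw [integral_finsetSum _ fun n _ => (P n).integrable_indicator]
  simp only [HalfOpenBox.integral_indicator]

section Singleton

variable {W : HalfOpenBox d}

theorem sum_indicator_add_coverage (h : IsPartialPacking r {W} N N' P Q) (x : Fin d → ℝ) :
    ∑ n ∈ Finset.Ico N N', (P n).indicator x + coverage Q x = W.indicator x := by
  simpa using congrFun h.coverage_eq x

theorem cube_subset (h : IsPartialPacking r {W} N N' P Q) {n : ℕ} (hn : n ∈ Finset.Ico N N') :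
    (P n).toSet ⊆ W.toSet :=
  toSet_subset_of_indicator_le fun x => by
    rw [← h.sum_indicator_add_coverage x]
    exact (Finset.single_le_sum (fun m _ => (P m).indicator_nonneg x) hn).trans
      (le_add_of_nonneg_right (coverage_nonneg Q x))

theorem leftover_subset (h : IsPartialPacking r {W} N N' P Q) {B : HalfOpenBox d} (hB : B ∈ Q) :
    B.toSet ⊆ W.toSet :=
  toSet_subset_of_indicator_le fun x => by
    rw [← h.sum_indicator_add_coverage x]
    exact (indicator_le_coverage hB x).trans
      (le_add_of_nonneg_left (Finset.sum_nonneg fun n _ => (P n).indicator_nonneg x))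

theorem disjoint_cubes (h : IsPartialPacking r {W} N N' P Q) {m n : ℕ}
    (hm : m ∈ Finset.Ico N N') (hn : n ∈ Finset.Ico N N') (hmn : m ≠ n) :
    Disjoint (P m).toSet (P n).toSet := by
  refine Set.disjoint_left.2 fun x hxm hxn => ?_
  have hsub : {m, n} ⊆ Finset.Ico N N' := by
    simp [Finset.insert_subset_iff, hm, hn]
  have htwo : (P m).indicator x + (P n).indicator x ≤ W.indicator x := by
    rw [← h.sum_indicator_add_coverage x, ← Finset.sum_pair (f := fun k => (P k).indicator x) hmn]
    exact (Finset.sum_le_sum_of_subset_of_nonneg hsub fun k _ _ => (P k).indicator_nonneg x).trans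
      (le_add_of_nonneg_right (coverage_nonneg Q x))
  rw [indicator_of_mem hxm, indicator_of_mem hxn] at htwo
  linarith [W.indicator_le_one x]

end Singleton

theorem exists_of_forall_mem {w : HalfOpenBox d → ℝ} {E : ℝ} (N : ℕ)
    (hS : ∀ C ∈ S, ∀ n ∈ Finset.Ico N (N + S.card),
      ∃ P Q, IsPartialPacking r {C} n (n + 1) P Q ∧ (Q.map w).sum ≤ E) :
    ∃ P Q, IsPartialPacking r S N (N + S.card) P Q ∧ (Q.map w).sum ≤ S.card * E := by
  induction S using Multiset.induction generalizing N with
  | empty =>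
    obtain ⟨B⟩ : Nonempty (HalfOpenBox d) := ⟨⟨0, 0, le_rfl⟩⟩
    exact ⟨fun _ => B, 0, refl r 0 N _, by simp⟩
  | cons C S ih =>
    simp only [Multiset.card_cons] at hS ⊢
    obtain ⟨P₁, Q₁, h₁, hw₁⟩ := hS C (Multiset.mem_cons_self C S) N (by simp)
    obtain ⟨P₂, Q₂, h₂, hw₂⟩ := ih (N + 1) fun D hD n hn =>
      hS D (Multiset.mem_cons_of_mem hD) n (by simp only [Finset.mem_Ico] at hn ⊢; omega)
    have h₂' := h₂.add_right Q₁
    rw [add_comm S, add_comm Q₂] at h₂'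
    obtain ⟨P, -, h⟩ := (h₁.add_right S).exists_append h₂'
    refine ⟨P, Q₁ + Q₂, ?_, ?_⟩
    · rwa [← Multiset.singleton_add, add_comm S.card, ← add_assoc]
    · rw [Multiset.map_add, Multiset.sum_add]
      push_cast
      linarith

theorem of_corner {n : ℕ} {B : HalfOpenBox d} (hr : 0 ≤ fun _ : Fin d => r n)
    (hrB : (fun _ => r n) ≤ B.side) :
    IsPartialPacking r {B} n (n + 1) (fun _ => B.corner hr)
      (Finset.univ.val.map (B.collar hr hrB)) where
  le := n.le_succ
  side_eq m hm := by
    obtain rfl : m = n := by simpa using hm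
    rfl
  coverage_eq := by
    rw [coverage_map_val, coverage_singleton, Nat.Ico_succ_singleton, Finset.sum_singleton,
      indicator_corner_add_sum_collar]

theorem exists_cube_in_cell {n : ℕ} {s g ε : ℝ} {C : HalfOpenBox d} (hC : C.side = fun _ => s)
    (hε₀ : 0 ≤ ε) (hε₁ : ε ≤ 1) (hg : 0 < g) (hgs : g ≤ s) (hr₀ : 0 ≤ r n) (hgr : s - g ≤ r n)
    (hrs : r n ≤ s) :
    ∃ P Q, IsPartialPacking r {C} n (n + 1) P Q ∧
      (Q.map (weight ε)).sum ≤ (d : ℝ) ^ 2 * (g ^ ε * s ^ (d - 1)) := by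
  have hr : 0 ≤ fun _ : Fin d => r n := fun _ => hr₀
  have hrC : (fun _ => r n) ≤ C.side := fun j => by rw [hC]; exact hrs
  refine ⟨_, _, of_corner hr hrC, ?_⟩
  have hcollar (i : Fin d) :
      (C.collar hr hrC i).weight ε ≤ d * (g ^ ε * s ^ (d - 1)) := by
    have hprod : g ^ (ε - 1) * ∏ j, Function.update (fun _ : Fin d => s) i g j =
        g ^ ε * s ^ (d - 1) := by
      rw [Real.rpow_sub_one hg.ne']
      simp [Finset.prod_update_of_mem, Finset.card_sdiff]
      field_simp
    rw [← hprod]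
    refine weight_le_of_side_le hε₀ hε₁ hg (fun j => ?_) fun j => ?_
    · rcases eq_or_ne j i with rfl | hj
      · simp only [collar, lt_irrefl, if_false, if_true, hC, Function.update_self]
        linarith
      · simp only [collar, hj, if_false, hC, Function.update_of_ne hj]
        split_ifs <;> linarith
    · rcases eq_or_ne j i with rfl | hj
      · simp
      · simpa [hj] using hgs
  rw [Multiset.map_map]
  exact (Finset.sum_le_card_nsmul _ _ _ fun i _ => hcollar i).trans_eq (by simp [sq, mul_assoc])

end IsPartialPacking

namespace HalfOpenBox

section Layer

variable {d : ℕ} [NeZero d] {B : HalfOpenBox d} {s : ℝ}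

/-- The number of cells of mesh `s` along the `j`-th side of `B` in a maximal grid of cells that is
only one cell thick in the direction of the `0`-th axis. -/
noncomputable def layerCount (B : HalfOpenBox d) (s : ℝ) (j : Fin d) : ℕ :=
  if j = 0 then 1 else ⌊B.side j / s⌋₊

/-- The number of cells of mesh `s` in one layer of cells in `B`. -/
noncomputable def layerCard (B : HalfOpenBox d) (s : ℝ) : ℕ := ∏ j, B.layerCount s j

theorem one_le_layerCount (hs : 0 < s) (hsB : ∀ j, s ≤ B.side j) (j : Fin d) :
    1 ≤ B.layerCount s j := by
  rw [layerCount]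
  split_ifs
  · exact le_rfl
  · exact Nat.le_floor (by rw [Nat.cast_one]; exact (one_le_div hs).2 (hsB j))

theorem layerCount_mul_le (hs : 0 < s) (hsB : ∀ j, s ≤ B.side j) (j : Fin d) :
    B.layerCount s j * s ≤ B.side j := by
  rw [layerCount]
  split_ifs
  · simpa using hsB j
  · exact (le_div_iff₀ hs).1 (Nat.floor_le (div_nonneg (B.side_nonneg j) hs.le))

theorem side_le_layerCount_mul_add (hs : 0 < s) {j : Fin d} (hj : j ≠ 0) :
    B.side j ≤ B.layerCount s j * s + s := by
  rw [layerCount, if_neg hj, ← add_one_mul]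
  exact (div_le_iff₀ hs).1 (Nat.lt_floor_add_one (B.side j / s)).le

theorem side_le_two_mul_layerCount (hs : 0 < s) (hsB : ∀ j, s ≤ B.side j) {j : Fin d}
    (hj : j ≠ 0) : B.side j ≤ 2 * s * B.layerCount s j := by
  have : (1 : ℝ) ≤ B.layerCount s j := mod_cast one_le_layerCount hs hsB j
  nlinarith [side_le_layerCount_mul_add (B := B) hs hj]

theorem layerCard_pos (hs : 0 < s) (hsB : ∀ j, s ≤ B.side j) : 0 < B.layerCard s :=
  Finset.prod_pos fun j _ => one_le_layerCount hs hsB j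

theorem layerCard_le {M : ℝ} (hs : 0 < s) (hsB : ∀ j, s ≤ B.side j) (hBM : ∀ j, B.side j ≤ M) :
    (B.layerCard s : ℝ) ≤ (M / s) ^ (d - 1) := by
  rw [layerCard, Nat.cast_prod, ← Finset.mul_prod_erase Finset.univ _ (Finset.mem_univ 0)]
  calc (B.layerCount s 0 : ℝ) * ∏ j ∈ Finset.univ.erase 0, (B.layerCount s j : ℝ)
      ≤ 1 * ∏ _j ∈ Finset.univ.erase (0 : Fin d), M / s := by
        gcongr with j
        · simp [layerCount]
        · exact (le_div_iff₀ hs).2 ((layerCount_mul_le hs hsB j).trans (hBM j))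
    _ = (M / s) ^ (d - 1) := by simp [div_pow]

variable {ε θ : ℝ} (hu : 0 ≤ fun j => B.layerCount s j * s)
  (huB : (fun j => B.layerCount s j * s) ≤ B.side)

theorem weight_collar_layer_le (hε₀ : 0 ≤ ε) (hε₁ : ε ≤ 1) (hs : 0 < s) (hsθ : s ≤ θ)
    (hB : ∀ j, θ ≤ B.side j) {i : Fin d} (hi : i ≠ 0) :
    (B.collar hu huB i).weight ε ≤ d * (B.layerCard s * (2 ^ d * s ^ d * s ^ ε / θ)) := by
  have hθ : 0 < θ := hs.trans_le hsθ
  have hsB (j : Fin d) : s ≤ B.side j := hsθ.trans (hB j)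
  have hcount (j : Fin d) : (1 : ℝ) ≤ B.layerCount s j := mod_cast one_le_layerCount hs hsB j
  -- `2 * s * B.layerCount s j` bounds the `j`-th side of `B` for `j ≠ 0`, and the factor `s / θ`
  -- accounts for the thickness of the `i`-th piece, which is at most `s` instead of `θ`.
  let u : Fin d → ℝ := fun j => 2 * s * B.layerCount s j * if j = i then s / θ else 1
  have hui : s ≤ u i := by
    have : θ ≤ 2 * s * B.layerCount s i := (hB i).trans (side_le_two_mul_layerCount hs hsB hi)
    simp only [u, if_true, ← mul_div_assoc, le_div_iff₀ hθ, mul_comm s θ]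
    gcongr
  have huj {j : Fin d} (hj : j ≠ i) : u j = 2 * s * B.layerCount s j := by simp [u, hj]
  have hprod : s ^ (ε - 1) * ∏ j, u j = B.layerCard s * (2 ^ d * s ^ d * s ^ ε / θ) := by
    simp only [u, Finset.prod_mul_distrib, Finset.prod_ite_eq', Finset.mem_univ, if_true,
      Finset.prod_const, Finset.card_univ, Fintype.card_fin, layerCard,
      Nat.cast_prod, Real.rpow_sub_one hs.ne']
    field_simp
  rw [← hprod]
  refine weight_le_of_side_le hε₀ hε₁ hs (fun j => ?_) fun j => ?_
  · rcases lt_trichotomy j i with hj | rfl | hj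
    · simp only [collar, hj, if_true, huj hj.ne]
      nlinarith [hcount j]
    · simp only [collar, lt_irrefl, if_false, if_true]
      linarith [side_le_layerCount_mul_add (B := B) hs hi]
    · simp only [collar, hj.not_gt, hj.ne', if_false, huj hj.ne']
      exact side_le_two_mul_layerCount hs hsB ((Fin.zero_le i).trans_lt hj).ne'
  · rcases eq_or_ne j i with rfl | hj
    · exact hui
    · rw [huj hj]
      nlinarith [hcount j]

theorem sum_weight_collar_layer_le (hε₀ : 0 ≤ ε) (hε₁ : ε ≤ 1) (hs : 0 < s) (hsθ : s ≤ θ)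
    (hB : ∀ j, θ ≤ B.side j) : ∑ i, (B.collar hu huB i).weight ε ≤
      B.weight ε + B.layerCard s * (d ^ 2 * (2 ^ d * s ^ d * s ^ ε / θ)) := by
  have hθ : 0 < θ := hs.trans_le hsθ
  rw [← Finset.add_sum_erase Finset.univ _ (Finset.mem_univ 0)]
  gcongr
  · exact weight_mono hε₀ (B.collar_side_le hu huB 0)
  · calc _ ≤ ((Finset.univ.erase (0 : Fin d)).card : ℝ) *
          (d * (B.layerCard s * (2 ^ d * s ^ d * s ^ ε / θ))) := by
          rw [← nsmul_eq_mul]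
          exact Finset.sum_le_card_nsmul _ _ _ fun i hi =>
            weight_collar_layer_le hu huB hε₀ hε₁ hs hsθ hB (Finset.ne_of_mem_erase hi)
      _ ≤ d * (d * (B.layerCard s * (2 ^ d * s ^ d * s ^ ε / θ))) := by
          gcongr
          simp
      _ = B.layerCard s * (d ^ 2 * (2 ^ d * s ^ d * s ^ ε / θ)) := by ring

end Layer

end HalfOpenBox

theorem IsPartialPacking.exists_layer {d : ℕ} [NeZero d] {r : ℕ → ℝ} {ε s θ g : ℝ} (hε₀ : 0 ≤ ε)
    (hε₁ : ε ≤ 1) (hs : 0 < s) (hsθ : s ≤ θ) (hg : 0 < g) (hgs : g ≤ s) {B : HalfOpenBox d}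
    (hB : ∀ j, θ ≤ B.side j) {N : ℕ}
    (hr : ∀ n ∈ Finset.Ico N (N + B.layerCard s), s - g ≤ r n ∧ r n ≤ s) :
    ∃ P Q, IsPartialPacking r {B} N (N + B.layerCard s) P Q ∧
      (Q.map (weight ε)).sum ≤ B.weight ε + B.layerCard s *
        (d ^ 2 * (2 ^ d * s ^ d * s ^ ε / θ + g ^ ε * s ^ (d - 1))) := by
  have hu : 0 ≤ fun j => B.layerCount s j * s := fun j => by positivity
  have huB : (fun j => B.layerCount s j * s) ≤ B.side :=
    fun j => layerCount_mul_le hs (fun i => hsθ.trans (hB i)) j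
  let cells : Multiset (HalfOpenBox d) :=
    (Fintype.piFinset fun j => Finset.range (B.layerCount s j)).val.map (B.cell hs.le)
  have hcard : cells.card = B.layerCard s := by
    simp [cells, layerCard]
  obtain ⟨P, Q, h, hQ⟩ := exists_of_forall_mem (S := cells) (r := r) (w := weight ε)
    (E := d ^ 2 * (g ^ ε * s ^ (d - 1))) N fun C hC n hn => by
      obtain ⟨κ, -, rfl⟩ := Multiset.mem_map.1 hC
      obtain ⟨hgr, hrs⟩ := hr n (hcard ▸ hn)
      exact exists_cube_in_cell rfl hε₀ hε₁ hg hgs ((sub_nonneg.2 hgs).trans hgr) hgr hrs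
  rw [hcard] at h hQ
  let collars : Multiset (HalfOpenBox d) := Finset.univ.val.map (B.collar hu huB)
  have hcut : coverage (cells + collars) = coverage {B} := by
    simp only [cells, collars, coverage_add, coverage_map_val, coverage_singleton,
      B.sum_indicator_cell hs.le hu, indicator_corner_add_sum_collar]
  refine ⟨P, Q + collars, ⟨h.le, h.side_eq, (h.add_right collars).coverage_eq.trans hcut⟩, ?_⟩
  have hcollars : (collars.map (weight ε)).sum = ∑ i, (B.collar hu huB i).weight ε := by
    rw [Multiset.map_map]
    rfl
  rw [Multiset.map_add, Multiset.sum_add, hcollars]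
  linarith [sum_weight_collar_layer_le hu huB hε₀ hε₁ hs hsθ hB]

theorem rpow_neg_pow (n d : ℕ) (t : ℝ) : ((n : ℝ) ^ (-t)) ^ d = 1 / (n : ℝ) ^ (d * t) := by
  rw [← Real.rpow_mul_natCast n.cast_nonneg, one_div, ← Real.rpow_neg n.cast_nonneg, neg_mul,
    mul_comm]

theorem rpow_neg_sub_mul_le {x y t : ℝ} (hx : 0 < x) (hxy : x ≤ y) (ht : t ≤ 1) :
    x ^ (-t) - (y - x) * x ^ (-t - 1) ≤ y ^ (-t) := by
  have hy : 0 < y := hx.trans_le hxy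
  calc x ^ (-t) - (y - x) * x ^ (-t - 1) = x ^ (-t) * (1 - (y - x) / x) := by
        rw [Real.rpow_sub_one hx.ne']
        ring
    _ ≤ x ^ (-t) * (x / y) := by
        gcongr
        have hsq : x / y - (1 - (y - x) / x) = (y - x) ^ 2 / (x * y) := by
          field_simp
          ring
        rw [← sub_nonneg, hsq]
        positivity
    _ ≤ x ^ (-t) * (x / y) ^ t := by
        gcongr
        exact Real.self_le_rpow_of_le_one (by positivity) ((div_le_one hy).2 hxy) ht
    _ = y ^ (-t) := by
        rw [Real.div_rpow hx.le hy.le, Real.rpow_neg hx.le, Real.rpow_neg hy.le]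
        field_simp

theorem rpow_add_mul_rpow_le {α x k : ℝ} (hα₀ : 0 ≤ α) (hα₁ : α ≤ 1) (hx : 0 < x) (hk : 0 ≤ k)
    (hkx : k ≤ x) : x ^ α + k * (α * 2 ^ (α - 1) * x ^ (α - 1)) ≤ (x + k) ^ α := by
  have hy : 0 < x + k := by positivity
  have hbernoulli : x ^ α ≤ (x + k) ^ α - k * (α * (x + k) ^ (α - 1)) := by
    have := rpow_one_add_le_one_add_mul_self (s := -(k / (x + k))) (p := α)
      (by rw [neg_le_neg_iff, div_le_one hy]; linarith) hα₀ hα₁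
    rw [show 1 + -(k / (x + k)) = x / (x + k) by field_simp; ring, Real.div_rpow hx.le hy.le,
      div_le_iff₀ (by positivity)] at this
    rw [Real.rpow_sub_one hy.ne']
    linear_combination this
  have hdouble : (2 : ℝ) ^ (α - 1) * x ^ (α - 1) ≤ (x + k) ^ (α - 1) := by
    rw [← Real.mul_rpow two_pos.le hx.le]
    exact Real.rpow_le_rpow_of_nonpos hy (by linarith) (by linarith)
  have := mul_le_mul_of_nonneg_left hdouble (mul_nonneg hk hα₀)
  linarith

theorem sum_Ico_add_mul_le_tsum {f : ℕ → ℝ} (hf : Summable f) (hf₀ : 0 ≤ f) {n₀ N : ℕ}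
    (hanti : AntitoneOn f (Set.Ici n₀)) (hN : n₀ ≤ N) :
    ∑ n ∈ Finset.Ico n₀ N, f n + N * f (2 * N) ≤ ∑' n : Set.Ici n₀, f n := by
  have hblock : N * f (2 * N) ≤ ∑ n ∈ Finset.Ico N (2 * N), f n := by
    have := Finset.card_nsmul_le_sum (Finset.Ico N (2 * N)) f (f (2 * N)) fun n hn => by
      rw [Finset.mem_Ico] at hn
      exact hanti (hN.trans hn.1) (hN.trans (by omega)) hn.2.le
    rwa [Nat.card_Ico, nsmul_eq_mul, two_mul, Nat.add_sub_cancel, ← two_mul] at this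
  calc ∑ n ∈ Finset.Ico n₀ N, f n + N * f (2 * N)
      ≤ ∑ n ∈ Finset.Ico n₀ N, f n + ∑ n ∈ Finset.Ico N (2 * N), f n := by gcongr
    _ = ∑ n ∈ Finset.Ico n₀ (2 * N), f n := Finset.sum_Ico_consecutive f hN (by omega)
    _ = ∑ n ∈ Finset.Ico n₀ (2 * N), (Set.Ici n₀).indicator f n :=
        Finset.sum_congr rfl fun n hn =>
          (Set.indicator_of_mem (s := Set.Ici n₀) (Finset.mem_Ico.1 hn).1 f).symm
    _ ≤ ∑' n, (Set.Ici n₀).indicator f n :=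
        (hf.indicator _).sum_le_tsum _ fun n _ => Set.indicator_nonneg (fun n _ => hf₀ n) n
    _ = ∑' n : Set.Ici n₀, f n := (tsum_subtype (Set.Ici n₀) f).symm

/-- The exponents of the construction with cubes of sides `n ^ (-t)`. One layer, filled when the
next cube has index `N`, takes at most about `N ^ (1 - c)` cubes; a box is wide if its sides are at
least `N ^ (-t + c * ε)`; and the total weight of the leftover boxes is kept below a multiple of
`N ^ α`. -/
structure LayerExponents (d : ℕ) (t c ε α : ℝ) : Prop where
  t_pos : 0 < t
  t_le_one : t ≤ 1
  c_pos : 0 < c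
  ε_pos : 0 < ε
  ε_le_one : ε ≤ 1
  α_pos : 0 < α
  c_eq : (d - 1) * t + c = 1
  α_eq : (t + c) * ε + α = c

theorem exists_layerExponents {d : ℕ} (hd : 2 ≤ d) {t : ℝ} (ht₀ : 0 < t)
    (ht₁ : t < 1 / ((d : ℝ) - 1)) : ∃ c ε α, LayerExponents d t c ε α := by
  have hd' : (2 : ℝ) ≤ d := mod_cast hd
  rw [lt_div_iff₀ (by linarith)] at ht₁
  obtain ⟨c, hc⟩ : ∃ c, c = 1 - ((d : ℝ) - 1) * t := ⟨_, rfl⟩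
  have hc₀ : 0 < c := by linarith
  refine ⟨c, c / (2 * (t + c)), c / 2, ht₀, by nlinarith, hc₀, by positivity, ?_, by positivity,
    by linarith, by field_simp; ring⟩
  rw [div_le_one (by positivity)]
  linarith

theorem LayerExponents.α_le_one {d : ℕ} [NeZero d] {t c ε α : ℝ} (h : LayerExponents d t c ε α) :
    α ≤ 1 := by
  have hd : (1 : ℝ) ≤ d := mod_cast NeZero.one_le
  nlinarith [h.t_pos, h.c_pos, h.ε_pos, h.c_eq, h.α_eq, mul_nonneg (sub_nonneg.2 hd) h.t_pos.le]

section RpowSides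

variable {d : ℕ} {t c ε α M : ℝ}

theorem layerCard_rpow_le [NeZero d] (hc : (d - 1) * t + c = 1) {x : ℝ} (hx : 0 < x)
    {B : HalfOpenBox d} (hB : ∀ j, x ^ (-t) ≤ B.side j) (hBM : ∀ j, B.side j ≤ M) :
    (B.layerCard (x ^ (-t)) : ℝ) ≤ M ^ (d - 1) * x ^ (1 - c) :=
  calc (B.layerCard (x ^ (-t)) : ℝ) ≤ (M / x ^ (-t)) ^ (d - 1) :=
        layerCard_le (by positivity) hB hBM
    _ = M ^ (d - 1) * x ^ (1 - c) := by
      rw [Real.rpow_neg hx.le, div_inv_eq_mul, mul_pow, ← Real.rpow_mul_natCast hx.le,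
        Nat.cast_pred (NeZero.pos d), mul_comm t, eq_sub_of_add_eq hc]

theorem rpow_neg_sub_le_of_sub_le {A x y : ℝ} (hx : 0 < x) (hxy : x ≤ y) (ht : t ≤ 1)
    (hyx : y - x ≤ A * x ^ (1 - c)) : x ^ (-t) - A * x ^ (-t - c) ≤ y ^ (-t) :=
  calc x ^ (-t) - A * x ^ (-t - c) = x ^ (-t) - A * x ^ (1 - c) * x ^ (-t - 1) := by
        rw [mul_assoc, ← Real.rpow_add hx]
        ring_nf
    _ ≤ x ^ (-t) - (y - x) * x ^ (-t - 1) := by gcongr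
    _ ≤ y ^ (-t) := rpow_neg_sub_mul_le hx hxy ht

theorem rpow_layer_cost_eq (hd : 0 < d) (hc : (d - 1) * t + c = 1) (hα : (t + c) * ε + α = c)
    {A x : ℝ} (hA : 0 ≤ A) (hx : 0 < x) :
    2 ^ d * (x ^ (-t)) ^ d * (x ^ (-t)) ^ ε / x ^ (-t + c * ε) +
        (A * x ^ (-t - c)) ^ ε * (x ^ (-t)) ^ (d - 1) =
      (2 ^ d + A ^ ε) * x ^ (α - 1) := by
  have hcollar : (x ^ (-t)) ^ d * (x ^ (-t)) ^ ε / x ^ (-t + c * ε) = x ^ (α - 1) := by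
    rw [← Real.rpow_mul_natCast hx.le, ← Real.rpow_mul hx.le, ← Real.rpow_add hx,
      ← Real.rpow_sub hx]
    congr 1
    linear_combination -hα - hc
  have hcell : (x ^ (-t - c)) ^ ε * (x ^ (-t)) ^ (d - 1) = x ^ (α - 1) := by
    rw [← Real.rpow_mul_natCast hx.le, ← Real.rpow_mul hx.le, ← Real.rpow_add hx,
      Nat.cast_pred hd]
    congr 1
    linear_combination -hα - hc
  rw [Real.mul_rpow hA (by positivity), mul_assoc, mul_assoc, mul_div_assoc, hcollar, hcell,
    add_mul]

theorem IsPartialPacking.exists_layer_rpow [NeZero d] (hexp : LayerExponents d t c ε α)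
    (hM : 0 < M) {N : ℕ} (hN : 0 < N) (hMN : M ^ (d - 1) ≤ (N : ℝ) ^ c)
    {B : HalfOpenBox d} (hB : ∀ j, (N : ℝ) ^ (-t + c * ε) ≤ B.side j) (hBM : ∀ j, B.side j ≤ M) :
    ∃ k : ℕ, 0 < k ∧ k ≤ N ∧ ∃ P Q,
      IsPartialPacking (fun n => (n : ℝ) ^ (-t)) {B} N (N + k) P Q ∧
      (Q.map (weight ε)).sum ≤
        B.weight ε + k * (d ^ 2 * (2 ^ d + (M ^ (d - 1)) ^ ε) * (N : ℝ) ^ (α - 1)) := by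
  obtain ⟨ht₀, ht₁, hc₀, hε₀, hε₁, -, hc, hα⟩ := hexp
  have hx : (0 : ℝ) < N := mod_cast hN
  set s : ℝ := (N : ℝ) ^ (-t)
  have hs : 0 < s := by positivity
  have hsθ : s ≤ (N : ℝ) ^ (-t + c * ε) :=
    Real.rpow_le_rpow_of_exponent_le (mod_cast hN) (le_add_of_nonneg_right (by positivity))
  have hsB (j : Fin d) : s ≤ B.side j := hsθ.trans (hB j)
  have hgs : M ^ (d - 1) * (N : ℝ) ^ (-t - c) ≤ s := by
    rw [Real.rpow_sub hx, mul_div_left_comm]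
    exact mul_le_of_le_one_right hs.le ((div_le_one (by positivity)).2 hMN)
  have hk : (B.layerCard s : ℝ) ≤ M ^ (d - 1) * (N : ℝ) ^ (1 - c) :=
    layerCard_rpow_le hc hx hsB hBM
  have hkN : M ^ (d - 1) * (N : ℝ) ^ (1 - c) ≤ N := by
    rw [Real.rpow_sub hx, Real.rpow_one, mul_div_left_comm]
    exact mul_le_of_le_one_right hx.le ((div_le_one (by positivity)).2 hMN)
  have hr : ∀ n ∈ Finset.Ico N (N + B.layerCard s),
      s - M ^ (d - 1) * (N : ℝ) ^ (-t - c) ≤ (n : ℝ) ^ (-t) ∧ (n : ℝ) ^ (-t) ≤ s := by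
    intro n hn
    obtain ⟨hNn, hnk⟩ := Finset.mem_Ico.1 hn
    have hNn' : (N : ℝ) ≤ n := mod_cast hNn
    have hnk' : (n : ℝ) ≤ N + B.layerCard s := mod_cast hnk.le
    exact ⟨rpow_neg_sub_le_of_sub_le hx hNn' ht₁ (by linarith),
      Real.rpow_le_rpow_of_nonpos hx hNn' (neg_nonpos.2 ht₀.le)⟩
  obtain ⟨P, Q, h, hQ⟩ :=
    IsPartialPacking.exists_layer hε₀.le hε₁ hs hsθ (by positivity) hgs hB hr
  refine ⟨_, layerCard_pos hs hsB, mod_cast hk.trans hkN, P, Q, h, ?_⟩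
  rwa [rpow_layer_cost_eq (NeZero.pos d) hc hα (by positivity) hx, ← mul_assoc ((d : ℝ) ^ 2)] at hQ

theorem IsPartialPacking.exists_wide_leftover (hexp : LayerExponents d t c ε α)
    (hdt : 1 < d * t) {W : HalfOpenBox d} {n₀ N : ℕ} (hn₀ : 0 < n₀)
    (hW : W.vol = ∑' n : Set.Ici n₀, 1 / ((n : ℕ) : ℝ) ^ (d * t))
    {P : ℕ → HalfOpenBox d} {Q : Multiset (HalfOpenBox d)}
    (h : IsPartialPacking (fun n => (n : ℝ) ^ (-t)) {W} n₀ N P Q) {K : ℝ}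
    (hQ : (Q.map (weight ε)).sum ≤ K * (N : ℝ) ^ α)
    (hK : K * (N : ℝ) ^ (-(c * ε ^ 2)) < 2 ^ (-(d * t))) :
    ∃ B ∈ Q, ∀ j, (N : ℝ) ^ (-t + c * ε) ≤ B.side j := by
  have hx : (0 : ℝ) < N := mod_cast hn₀.trans_le h.le
  have hanti : AntitoneOn (fun n : ℕ => 1 / (n : ℝ) ^ (d * t)) (Set.Ici n₀) := by
    intro m hm n _ hmn
    have : (0 : ℝ) < m := mod_cast hn₀.trans_le hm
    dsimp only
    gcongr
  have hvol : N * (1 / ((2 * N : ℕ) : ℝ) ^ (d * t)) ≤ (Q.map vol).sum := by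
    have htail := sum_Ico_add_mul_le_tsum (Real.summable_one_div_nat_rpow.2 hdt)
      (fun n => by positivity) hanti h.le
    have hsum := h.sum_vol
    simp only [rpow_neg_pow, Multiset.map_singleton, Multiset.sum_singleton] at hsum
    linarith
  refine exists_forall_le_side hexp.ε_le_one (lt_of_lt_of_le ?_ hvol)
  have hadd : (-t + c * ε) * (1 - ε) + α = -(c * ε ^ 2) + (1 - d * t) := by
    linear_combination hexp.α_eq + hexp.c_eq
  calc ((N : ℝ) ^ (-t + c * ε)) ^ (1 - ε) * (Q.map (weight ε)).sum
      ≤ ((N : ℝ) ^ (-t + c * ε)) ^ (1 - ε) * (K * (N : ℝ) ^ α) := by gcongr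
    _ = K * (N : ℝ) ^ (-(c * ε ^ 2)) * (N : ℝ) ^ (1 - d * t) := by
      rw [← Real.rpow_mul hx.le, mul_left_comm, mul_assoc, ← Real.rpow_add hx, ← Real.rpow_add hx,
        hadd]
    _ < 2 ^ (-(d * t)) * (N : ℝ) ^ (1 - d * t) := by gcongr
    _ = N * (1 / ((2 * N : ℕ) : ℝ) ^ (d * t)) := by
      rw [Nat.cast_mul, Nat.cast_two, Real.mul_rpow two_pos.le hx.le, Real.rpow_sub hx,
        Real.rpow_one, Real.rpow_neg two_pos.le]
      field_simp

theorem IsPartialPacking.exists_extension [NeZero d] (hexp : LayerExponents d t c ε α)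
    (hM : 0 < M) {W : HalfOpenBox d} (hWM : ∀ j, W.side j ≤ M) {n₀ N : ℕ} (hN : 0 < N)
    (hMN : M ^ (d - 1) ≤ (N : ℝ) ^ c) {P : ℕ → HalfOpenBox d} {Q : Multiset (HalfOpenBox d)}
    (h : IsPartialPacking (fun n => (n : ℝ) ^ (-t)) {W} n₀ N P Q) {K : ℝ} (hK₀ : 0 ≤ K)
    (hQ : (Q.map (weight ε)).sum ≤ K * (N : ℝ) ^ α)
    (hK : d ^ 2 * (2 ^ d + (M ^ (d - 1)) ^ ε) ≤ K * (α * 2 ^ (α - 1)))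
    (hwide : ∃ B ∈ Q, ∀ j, (N : ℝ) ^ (-t + c * ε) ≤ B.side j) :
    ∃ N' > N, ∃ P', (∀ n < N, P' n = P n) ∧ ∃ Q',
      IsPartialPacking (fun n => (n : ℝ) ^ (-t)) {W} n₀ N' P' Q' ∧
      (Q'.map (weight ε)).sum ≤ K * (N' : ℝ) ^ α := by
  have hx : (0 : ℝ) < N := mod_cast hN
  obtain ⟨B, hBQ, hB⟩ := hwide
  have hBM (j : Fin d) : B.side j ≤ M :=
    (side_le_of_toSet_subset (fun i => lt_of_lt_of_le (by positivity) (hB i))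
      (h.leftover_subset hBQ) j).trans (hWM j)
  obtain ⟨k, hk, hkN, P₁, Q₁, h₁, hQ₁⟩ :=
    IsPartialPacking.exists_layer_rpow hexp hM hN hMN hB hBM
  obtain ⟨R, rfl⟩ := Multiset.exists_cons_of_mem hBQ
  obtain ⟨P', hP', h'⟩ := h.exists_append (h₁.add_right R)
  refine ⟨N + k, by omega, P', hP', _, h', ?_⟩
  rw [Multiset.map_cons, Multiset.sum_cons] at hQ
  rw [Multiset.map_add, Multiset.sum_add]
  calc (Q₁.map (weight ε)).sum + (R.map (weight ε)).sum
      ≤ K * (N : ℝ) ^ α + k * (d ^ 2 * (2 ^ d + (M ^ (d - 1)) ^ ε) * (N : ℝ) ^ (α - 1)) := by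
        linarith
    _ ≤ K * (N : ℝ) ^ α + k * (K * (α * 2 ^ (α - 1)) * (N : ℝ) ^ (α - 1)) := by gcongr
    _ = K * ((N : ℝ) ^ α + k * (α * 2 ^ (α - 1) * (N : ℝ) ^ (α - 1))) := by ring
    _ ≤ K * ((N : ℝ) + k) ^ α := by
        gcongr
        exact rpow_add_mul_rpow_le hexp.α_pos.le hexp.α_le_one hx k.cast_nonneg (mod_cast hkN)
    _ = K * ((N + k : ℕ) : ℝ) ^ α := by rw [Nat.cast_add]

end RpowSides

theorem exists_forall_ge_of_extension {α : Type*} {p : ℕ → (ℕ → α) → Prop} {N₀ : ℕ} {P₀ : ℕ → α}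
    (h₀ : p N₀ P₀) (hcongr : ∀ {N P P'}, p N P → (∀ n < N, P' n = P n) → p N P')
    (hstep : ∀ N P, p N P → ∃ N' > N, ∃ P', (∀ n < N, P' n = P n) ∧ p N' P') :
    ∃ P, ∀ m, ∃ N ≥ m, p N P := by
  have : Nonempty α := ⟨P₀ 0⟩
  choose! N' hN' P' hP' hp' using hstep
  let S : ℕ → ℕ × (ℕ → α) := fun i => (fun S => (N' S.1 S.2, P' S.1 S.2))^[i] (N₀, P₀)
  have hS (i : ℕ) : S (i + 1) = (N' (S i).1 (S i).2, P' (S i).1 (S i).2) :=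
    Function.iterate_succ_apply' _ i _
  have hp (i : ℕ) : p (S i).1 (S i).2 := by
    induction i with
    | zero => exact h₀
    | succ i ih => rw [hS]; exact hp' _ _ ih
  have hmono : StrictMono fun i => (S i).1 := strictMono_nat_of_lt_succ fun i => by
    rw [hS]
    exact hN' _ _ (hp i)
  have hagree {i j n : ℕ} (hij : i ≤ j) (hn : n < (S i).1) : (S j).2 n = (S i).2 n := by
    induction j, hij using Nat.le_induction with
    | base => rfl
    | succ j hij ih =>
      rw [hS]
      exact (hP' _ _ (hp j) n (hn.trans_le (hmono.monotone hij))).trans ih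
  have hlt (n : ℕ) : n < (S (n + 1)).1 := n.lt_succ_self.trans_le (hmono.le_apply)
  refine ⟨fun n => (S (n + 1)).2 n, fun m => ⟨_, hmono.le_apply, hcongr (hp m) fun n hn => ?_⟩⟩
  rcases le_total m (n + 1) with h | h
  · exact hagree h hn
  · exact (hagree h (hlt n)).symm

theorem exists_forall_isPartialPacking {d : ℕ} [NeZero d] {t c ε α M : ℝ}
    (hexp : LayerExponents d t c ε α) (hdt : 1 < d * t) (hM : 0 < M) :
    ∃ N₀ : ℕ, 1 ≤ N₀ ∧ ∀ n₀, N₀ ≤ n₀ → ∀ W : HalfOpenBox d, (∀ j, W.side j ≤ M) →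
      W.vol = ∑' n : Set.Ici n₀, 1 / ((n : ℕ) : ℝ) ^ (d * t) →
      ∃ P, ∀ m, ∃ N ≥ m, ∃ Q, IsPartialPacking (fun n => (n : ℝ) ^ (-t)) {W} n₀ N P Q := by
  obtain ⟨K, hK₀, hKW, hKC⟩ : ∃ K : ℝ, 0 ≤ K ∧ d * (M ^ (ε - 1) * M ^ d) ≤ K ∧
      d ^ 2 * (2 ^ d + (M ^ (d - 1)) ^ ε) ≤ K * (α * 2 ^ (α - 1)) := by
    have hα : 0 < α * 2 ^ (α - 1) := mul_pos hexp.α_pos (by positivity)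
    simp only [← div_le_iff₀ hα]
    exact ⟨max _ _, le_max_of_le_left (by positivity), le_max_left _ _, le_max_right _ _⟩
  have hlarge : ∀ᶠ N : ℕ in Filter.atTop, M ^ (d - 1) ≤ (N : ℝ) ^ c :=
    ((tendsto_rpow_atTop hexp.c_pos).comp tendsto_natCast_atTop_atTop).eventually_ge_atTop _
  have hsmall : ∀ᶠ N : ℕ in Filter.atTop, K * (N : ℝ) ^ (-(c * ε ^ 2)) < 2 ^ (-(d * t)) := by
    have := ((tendsto_rpow_neg_atTop (mul_pos hexp.c_pos (pow_pos hexp.ε_pos 2))).comp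
      tendsto_natCast_atTop_atTop).const_mul K
    rw [mul_zero] at this
    exact this.eventually_lt_const (by positivity)
  obtain ⟨N₀, hN₀⟩ := Filter.eventually_atTop.1
    ((Filter.eventually_ge_atTop 1).and (hlarge.and hsmall))
  refine ⟨N₀, (hN₀ N₀ le_rfl).1, fun n₀ hn₀ W hWM hW => ?_⟩
  have hn₀' : 1 ≤ n₀ := (hN₀ n₀ hn₀).1
  have hweight : W.weight ε ≤ K * (n₀ : ℝ) ^ α :=
    ((weight_le_of_side_le hexp.ε_pos.le hexp.ε_le_one hM hWM fun _ => le_rfl).trans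
      (by simpa using hKW)).trans
      (le_mul_of_one_le_right hK₀ (Real.one_le_rpow (mod_cast hn₀') hexp.α_pos.le))
  obtain ⟨P, hP⟩ := exists_forall_ge_of_extension (P₀ := fun _ => W)
    (p := fun N P => ∃ Q, IsPartialPacking (fun n => (n : ℝ) ^ (-t)) {W} n₀ N P Q ∧
      (Q.map (weight ε)).sum ≤ K * (N : ℝ) ^ α)
    ⟨{W}, IsPartialPacking.refl _ _ _ _, by simpa using hweight⟩
    (fun ⟨Q, h, hQ⟩ hP => ⟨Q, h.congr fun n hn => hP n (Finset.mem_Ico.1 hn).2, hQ⟩)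
    fun N P ⟨Q, h, hQ⟩ => by
      obtain ⟨hN, hMN, hKN⟩ := hN₀ N (hn₀.trans h.le)
      exact h.exists_extension hexp hM hWM hN hMN hK₀ hQ hKC
        (h.exists_wide_leftover hexp hdt hn₀' hW hQ hKN)
  exact ⟨P, fun m => (hP m).imp fun N ⟨hN, Q, h, _⟩ => ⟨hN, Q, h⟩⟩

namespace IsBrickWithSides

variable {d : ℕ} {s : Fin d → ℝ} {B : Set (Fin d → ℝ)}

theorem volume_eq (h : IsBrickWithSides s B) : volume B = ENNReal.ofReal (∏ j, s j) := by
  obtain ⟨hs, σ, a, rfl⟩ := h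
  simp only [Real.volume_Icc_pi, add_sub_cancel_left,
    ← ENNReal.ofReal_prod_of_nonneg fun j _ => (hs (σ j)).le, Equiv.prod_comp σ s]

theorem volume_interior (h : IsBrickWithSides s B) :
    volume (interior B) = ENNReal.ofReal (∏ j, s j) := by
  rw [← h.volume_eq]
  obtain ⟨-, σ, a, rfl⟩ := h
  exact measure_congr (interior_ae_eq_of_null_frontier ((convex_Icc _ _).addHaar_frontier volume))

theorem side_le_of_volume_eq_tsum {L : ℝ} {f : ℕ → ℝ} {I : Set ℕ} [NeZero d]
    (h : IsBrickWithSides (fun _ : Fin d => L) B) (hf : Summable f) (hf₀ : ∀ n, 0 ≤ f n)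
    (hvol : volume B = ENNReal.ofReal (∑' n : I, f n)) : L ≤ max 1 (∑' n, f n) := by
  rw [h.volume_eq, Fin.prod_const] at hvol
  rcases le_total L 1 with hL | hL
  · exact le_max_of_le_left hL
  · have hpow : L ^ d = ∑' n : I, f n :=
      (ENNReal.ofReal_eq_ofReal_iff (pow_nonneg (zero_le_one.trans hL) d)
        (tsum_nonneg fun n : I => hf₀ n)).1 hvol
    exact le_max_of_le_right <|
      calc L ≤ L ^ d := le_self_pow₀ hL (NeZero.ne d)
        _ = ∑' n : I, f n := hpow
        _ ≤ ∑' n, f n := hf.tsum_subtype_le f I hf₀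

end IsBrickWithSides

theorem IsPackingIn.perfectlyPack {d : ℕ} {ι : Type*} [Countable ι] {s : ι → Fin d → ℝ}
    {Ω : Set (Fin d → ℝ)} {P : ι → Set (Fin d → ℝ)} (h : IsPackingIn s Ω P)
    (hΩ : volume Ω ≠ ⊤) (hvol : ∑' i, ENNReal.ofReal (∏ j, s i j) = volume Ω) :
    PerfectlyPack s Ω := by
  have hmeas (i : ι) : MeasurableSet (interior (P i)) := isOpen_interior.measurableSet
  have hunion : volume (⋃ i, interior (P i)) = volume Ω := by
    rw [measure_iUnion h.disjoint_interior hmeas, ← hvol]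
    exact tsum_congr fun i => (h.isBrick i).volume_interior
  have hnull : volume (Ω \ ⋃ i, interior (P i)) = 0 := by
    rw [measure_sdiff (Set.iUnion_subset fun i => interior_subset.trans (h.subset i))
      (MeasurableSet.iUnion hmeas).nullMeasurableSet (hunion.trans_ne hΩ), hunion, tsub_self]
  exact ⟨P, h, measure_mono_null
    (Set.sdiff_subset_sdiff_right (Set.iUnion_mono fun _ => interior_subset)) hnull⟩

theorem isPackingIn_of_toSet {d : ℕ} {ι : Type*} {W : HalfOpenBox d} {P : ι → HalfOpenBox d}
    (hpos : ∀ i j, 0 < (P i).side j) (hsub : ∀ i, (P i).toSet ⊆ W.toSet)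
    (hdisj : Pairwise fun i j => Disjoint (P i).toSet (P j).toSet) :
    IsPackingIn (fun i => (P i).side) (Set.Icc W.lo (W.lo + W.side))
      fun i => Set.Icc (P i).lo ((P i).lo + (P i).side) where
  isBrick i := ⟨hpos i, 1, (P i).lo, rfl⟩
  disjoint_interior _ _ hij :=
    (hdisj hij).mono (interior_Icc_subset_toSet _) (interior_Icc_subset_toSet _)
  subset i := by
    rw [← closure_toSet (hpos i)]
    exact closure_minimal ((hsub i).trans W.toSet_subset_Icc) isClosed_Icc

theorem isPackingIn_of_forall_isPartialPacking {d : ℕ} {r : ℕ → ℝ} {n₀ : ℕ} {W : HalfOpenBox d}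
    {P : ℕ → HalfOpenBox d} (hr : ∀ n ≥ n₀, 0 < r n)
    (hP : ∀ m, ∃ N ≥ m, ∃ Q, IsPartialPacking r {W} n₀ N P Q) :
    IsPackingIn (fun (n : Set.Ici n₀) (_ : Fin d) => r n) (Set.Icc W.lo (W.lo + W.side))
      fun n => Set.Icc (P n).lo ((P n).lo + (P n).side) := by
  have hmem {n m N : ℕ} (hn : n₀ ≤ n) (hnm : n ≤ m) (hN : m + 1 ≤ N) : n ∈ Finset.Ico n₀ N :=
    Finset.mem_Ico.2 ⟨hn, hnm.trans_lt hN⟩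
  have hside (n : Set.Ici n₀) : (P n).side = fun _ => r n := by
    obtain ⟨N, hN, Q, h⟩ := hP (n + 1)
    exact h.side_eq n (hmem n.2 le_rfl hN)
  have hsub (n : Set.Ici n₀) : (P n).toSet ⊆ W.toSet := by
    obtain ⟨N, hN, Q, h⟩ := hP (n + 1)
    exact h.cube_subset (hmem n.2 le_rfl hN)
  have hdisj : Pairwise fun m n : Set.Ici n₀ => Disjoint (P m).toSet (P n).toSet := by
    intro m n hmn
    obtain ⟨N, hN, Q, h⟩ := hP (max m n + 1)
    exact h.disjoint_cubes (hmem m.2 (le_max_left _ _) hN) (hmem n.2 (le_max_right _ _) hN)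
      (Subtype.coe_injective.ne hmn)
  have hpos (n : Set.Ici n₀) (j : Fin d) : 0 < (P n).side j := by
    rw [hside]
    exact hr n n.2
  simpa only [hside] using isPackingIn_of_toSet hpos hsub hdisj

theorem theorem1p1_general (d : ℕ) (hd : 2 ≤ d) (t : ℝ)
    (ht₁ : 1 / (d : ℝ) < t) (ht₂ : t < 1 / ((d : ℝ) - 1)) (M : ℝ) :
    ∃ N₀ : ℕ, 1 ≤ N₀ ∧ ∀ n₀ : ℕ, N₀ ≤ n₀ →
      Summable (fun n : Set.Ici n₀ => 1 / ((n : ℕ) : ℝ) ^ ((d : ℝ) * t)) ∧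
      ∀ (s : Fin d → ℝ) (Ω : Set (Fin d → ℝ)), IsBrickWithSides s Ω → (∀ j, s j ≤ M) →
        volume Ω = ENNReal.ofReal (∑' n : Set.Ici n₀, 1 / ((n : ℕ) : ℝ) ^ ((d : ℝ) * t)) →
        PerfectlyPack (fun (n : Set.Ici n₀) (_ : Fin d) => ((n : ℕ) : ℝ) ^ (-t)) Ω := by
  have : NeZero d := ⟨by omega⟩
  have hd₀ : 0 < (d : ℝ) := by positivity
  have ht₀ : 0 < t := (one_div_pos.2 hd₀).trans ht₁
  have hdt : 1 < d * t := (div_lt_iff₀' hd₀).1 ht₁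
  obtain ⟨c, ε, α, hexp⟩ := exists_layerExponents hd ht₀ ht₂
  obtain ⟨N₀, hN₀, hpack⟩ := exists_forall_isPartialPacking hexp hdt
    (lt_max_of_lt_left one_pos : 0 < max 1 M)
  refine ⟨N₀, hN₀, fun n₀ hn₀ => ?_⟩
  have hsum : Summable fun n : Set.Ici n₀ => 1 / ((n : ℕ) : ℝ) ^ (d * t) :=
    (Real.summable_one_div_nat_rpow.2 hdt).subtype _
  refine ⟨hsum, fun s Ω hΩ hsM hvol => ?_⟩
  have hvol' : ∏ j, s j = ∑' n : Set.Ici n₀, 1 / ((n : ℕ) : ℝ) ^ (d * t) := by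
    rw [hΩ.volume_eq] at hvol
    exact (ENNReal.ofReal_eq_ofReal_iff (Finset.prod_nonneg fun j _ => (hΩ.1 j).le)
      (tsum_nonneg fun n => by positivity)).1 hvol
  obtain ⟨hs, σ, a, rfl⟩ := hΩ
  obtain ⟨P, hP⟩ := hpack n₀ hn₀ ⟨a, s ∘ σ, fun j => (hs (σ j)).le⟩
    (fun j => le_max_of_le_right (hsM (σ j))) ((Equiv.prod_comp σ s).trans hvol')
  refine (isPackingIn_of_forall_isPartialPacking (fun n hn => ?_) hP).perfectlyPack
    (hvol.trans_ne ENNReal.ofReal_ne_top) ?_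
  · exact Real.rpow_pos_of_pos (mod_cast hN₀.trans (hn₀.trans hn)) _
  · refine .trans ?_ hvol.symm
    rw [ENNReal.ofReal_tsum_of_nonneg (fun n => by positivity) hsum]
    simp only [Fin.prod_const, rpow_neg_pow]

theorem theorem1p1 (d : ℕ) (hd : 2 ≤ d) (t : ℝ)
    (ht₁ : 1 / (d : ℝ) < t) (ht₂ : t < 1 / ((d : ℝ) - 1)) :
    ∃ N₀ : ℕ, 1 ≤ N₀ ∧ ∀ n₀ : ℕ, N₀ ≤ n₀ →
      Summable (fun n : Set.Ici n₀ => 1 / ((n : ℕ) : ℝ) ^ ((d : ℝ) * t)) ∧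
      ∀ Ω : Set (Fin d → ℝ), IsCube Ω →
        MeasureTheory.volume Ω =
          ENNReal.ofReal (∑' n : Set.Ici n₀, 1 / ((n : ℕ) : ℝ) ^ ((d : ℝ) * t)) →
        PerfectlyPack (fun (n : Set.Ici n₀) (_ : Fin d) => ((n : ℕ) : ℝ) ^ (-t)) Ω := by
  have : NeZero d := ⟨by omega⟩
  have hsum := Real.summable_one_div_nat_rpow.2 ((div_lt_iff₀' (by positivity)).1 ht₁)
  obtain ⟨N₀, hN₀, h⟩ := theorem1p1_general d hd t ht₁ ht₂ _
  exact ⟨N₀, hN₀, fun n₀ hn₀ => (h n₀ hn₀).imp_right fun hpack Ω ⟨L, hL⟩ hvol => hpack _ Ω hL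
    (fun _ => hL.side_le_of_volume_eq_tsum hsum (fun n => by positivity) hvol) hvol⟩
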